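/- Conventions. An $n$-qubit state is a unit vector of $(\mathbb C^2)^{\otimes n}$, with computational basis $\{|x\rangle : x\in\mathbb F_2^n\}$. A quantum circuit on $n$ qubits is a product of gates, each of which is an arbitrary unitary acting on at most two of the qubits. The circuit complexity of an $n$-qubit state $|\psi\rangle$ is the least number of gates of a circuit $V$ on $n$ qubits with $V|0^n\rangle=|\psi\rangle$. The set $\mathrm{Stab}_n$ of stabilizer states consists of the vectors $|A|^{-1/2}\sum_{x\in A} i^{\ell(x)}(-1)^{Q(x)}|x\rangle$, with $A\subseteq\mathbb F_2^n$ a nonempty affine subspace, $\ell:\mathbb F_2^n\to\mathbb F_2$ linear and $Q(x)=x^TBx+a^Tx$ quadratic over $\mathbb F_2$. The stabilizer rank $\chi(|\phi\rangle)$ is the least $M>0$ such that $|\phi\rangle$ is a complex linear combination of $M$ elements of $\mathrm{Stab}_n$, and $\chi_\delta(|\phi\rangle)=\min\{\chi(|\psi\rangle): \||\phi\rangle-|\psi\rangle\|\le\delta\}$, where $|\psi\rangle$ need not be normalized. Theorem. 1. There are absolute constants $c>0$, $A$ and $K\in\mathbb N$ such that for all $0\le\delta<1$ and all integers $n\geq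 1$ and $M\geq 0$ with $M\le c\,(1-\delta^2)^2\,2^n n^{-2}$, there is a quantum circuit $V$ on $n$ qubits with at most $\frac{A}{(1-\delta^2)^{K}}\,M(1+\log M)^K$ gates (with $\log 0:=0$) such that $\chi_\delta(V|0^n\rangle)\ge M$. In particular, for fixed $\delta$ the circuit has $M\,\mathrm{polylog}(M)$ gates. 2. For every real $d$ and every $0\le\delta<1$ there are constants $A$, $K$ and $N$ such that for every $n\ge N$ there is an $n$-qubit state $|\psi\rangle$ of circuit complexity at most $A\,n^d(\log n)^K$ with $\chi_\delta(|\psi\rangle)\ge n^d$ and $\chi(|\psi\rangle)\ge n^d$. -/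

import Mathlib

namespace StabRank

noncomputable section

/-- The vector space `𝔽₂ⁿ`, whose elements label the computational basis. -/
abbrev Bits (n : ℕ) : Type := Fin n → ZMod 2

/-- The Hilbert space `(ℂ²)^{⊗ n}` of `n` qubits, in the computational basis. -/
abbrev QState (n : ℕ) : Type := EuclideanSpace ℂ (Bits n)

/-- The state `|0ⁿ⟩`. -/
def ketZero (n : ℕ) : QState n := EuclideanSpace.single 0 1

/-! ### Quantum circuits -/

/-- A quantum gate on `n` qubits: an arbitrary unitary acting on a set of at most two qubits. -/
structure Gate (n : ℕ) where
  /-- the qubits on which the gate acts -/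
  supp : Finset (Fin n)
  card_le : supp.card ≤ 2
  /-- the unitary applied to those qubits -/
  U : Matrix.unitaryGroup (supp → ZMod 2) ℂ

/-- The operator of a gate on all `n` qubits: `U` on the qubits in `supp`, tensored with the
identity on the other qubits. -/
def Gate.toMatrix {n : ℕ} (g : Gate n) : Matrix (Bits n) (Bits n) ℂ :=
  Matrix.of fun x y =>
    if ∀ i, i ∉ g.supp → x i = y i then
      (g.U : Matrix (g.supp → ZMod 2) (g.supp → ZMod 2) ℂ) (fun i => x i) (fun i => y i)
    else 0

/-- A circuit is a finite sequence of gates; the number of gates is the length of the list. -/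
abbrev Circuit (n : ℕ) : Type := List (Gate n)

/-- The unitary of a circuit `V₁, …, V_m`: the product `V₁ ⋯ V_m`. -/
def Circuit.toMatrix {n : ℕ} (V : Circuit n) : Matrix (Bits n) (Bits n) ℂ :=
  (List.map Gate.toMatrix V).prod

/-- The output state `V|0ⁿ⟩` of a circuit. -/
def Circuit.output {n : ℕ} (V : Circuit n) : QState n :=
  WithLp.toLp 2 (Matrix.mulVec (Circuit.toMatrix V) (WithLp.ofLp (ketZero n)))

/-- The circuit complexity of a state: the least number of gates of a circuit `V` on `n` qubits
with `V|0ⁿ⟩ = ψ` (it is `⊤` if there is none). -/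
def circuitComplexity {n : ℕ} (ψ : QState n) : ℕ∞ :=
  ⨅ (V : Circuit n) (_ : Circuit.output V = ψ), (V.length : ℕ∞)

/-! ### Stabilizer states and the stabilizer rank -/

/-- Quadratic functions `x ↦ xᵀ B x + aᵀ x` on `𝔽₂ⁿ`. -/
def IsQuadratic {n : ℕ} (Q : Bits n → ZMod 2) : Prop :=
  ∃ (B : Matrix (Fin n) (Fin n) (ZMod 2)) (a : Bits n),
    ∀ x, Q x = dotProduct x (Matrix.mulVec B x) + dotProduct a x

open Classical in
/-- The vector `|A|^{-1/2} ∑_{x ∈ A} i^{ℓ(x)} (-1)^{Q(x)} |x⟩`, where the exponents are the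
representatives in `{0, 1}`. -/
def stabVector {n : ℕ} (A : AffineSubspace (ZMod 2) (Bits n))
    (l : Bits n →ₗ[ZMod 2] ZMod 2) (Q : Bits n → ZMod 2) : QState n :=
  WithLp.toLp 2 fun x =>
    if x ∈ A then
      (1 / (Real.sqrt (Nat.card A) : ℂ)) * Complex.I ^ (l x).val * (-1 : ℂ) ^ (Q x).val
    else 0

/-- The set `Stab_n` of `n`-qubit stabilizer states. -/
def Stab (n : ℕ) : Set (QState n) :=
  {s | ∃ (A : AffineSubspace (ZMod 2) (Bits n)) (l : Bits n →ₗ[ZMod 2] ZMod 2)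
      (Q : Bits n → ZMod 2),
      (A : Set (Bits n)).Nonempty ∧ IsQuadratic Q ∧ s = stabVector A l Q}

/-- The stabilizer rank `χ(φ)`: the least `M > 0` such that `φ` is a linear combination of `M`
stabilizer states. (Such an `M` always exists, as the computational basis consists of
stabilizer states.) -/
def stabRank {n : ℕ} (φ : QState n) : ℕ :=
  sInf {M : ℕ | 0 < M ∧ ∃ (c : Fin M → ℂ) (s : Fin M → QState n),
    (∀ i, s i ∈ Stab n) ∧ φ = ∑ i, c i • s i}

/-- The approximate stabilizer rank `χ_δ(φ)`: the least value of `χ(ψ)` over all vectors `ψ`, not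
necessarily normalized, with `‖φ - ψ‖ ≤ δ`. -/
def approxStabRank {n : ℕ} (δ : ℝ) (φ : QState n) : ℕ :=
  sInf {m : ℕ | ∃ ψ : QState n, ‖φ - ψ‖ ≤ δ ∧ stabRank ψ = m}

end

end StabRank

namespace StabRank

/-! The hard states are the sign states `2^{-m/2} ∑ (-1)^{f x} |x⟩` on `m` of the `n` qubits, and a
good `f` is found by counting. If a multiple of `signVec f` lies near a subspace `W`, then its
projection to `W` has squared norm at least `(1 - δ²) 2^m`. For uniformly random `f`, the
exponential of a quarter of that squared norm has mean at most `2 ^ dim W` (`sum_exp_inner_le`), so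
only a fraction `2 ^ dim W * exp (-(1 - δ²) 2^m / 4)` of all `f` is near `W`
(`card_signVec_near_le`). Up to scalars there are at most `2^{O(m²)}` stabilizer states, hence
`2^{O(m² M)}` spans of `M` of them, and a union bound leaves a good `f` once `m² M` is a small
multiple of `(1 - δ²) 2^m` (`exists_signVec_far`).

Any sign state on `m` qubits is prepared by `O(m 2^m)` gates: the Walsh expansion writes the
diagonal sign operator as a product of `2^m` parity phases (`exists_circuit_sign`). Projecting the
other `n - m` qubits to zero does not increase distances and sends stabilizer states to multiples of
stabilizer states, so hardness on `m` qubits passes to `n` qubits. Taking the least admissible `m`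
makes `2^m` proportional to `M` up to logarithms and powers of `1 - δ²`
(`exists_circuit_of_rank_le`); the second statement takes `M = ⌈n^d⌉`. -/

/-! ### Random sign vectors and low-dimensional subspaces -/

/-- The sign vector `x ↦ (-1)^{f x}`. -/
noncomputable def signVec {X : Type*} (f : X → ZMod 2) : EuclideanSpace ℂ X :=
  WithLp.toLp 2 fun x => (-1 : ℂ) ^ (f x).val

/-- Gaussian linearization: this expresses `exp (t² / 4)` as an average of exponentials linear in
`t`, which factor over independent signs. -/
lemma integral_exp_neg_sq_add_mul (t : ℝ) :
    ∫ g : ℝ, Real.exp (-g ^ 2 + g * t) = √Real.pi * Real.exp (t ^ 2 / 4) := by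
  have h : ∀ g : ℝ, Real.exp (-g ^ 2 + g * t) =
      Real.exp (t ^ 2 / 4) * (fun g : ℝ => Real.exp (-1 * g ^ 2)) (g - t / 2) := by
    intro g
    simp only [← Real.exp_add]
    congr 1; ring
  simp_rw [h]
  rw [MeasureTheory.integral_const_mul,
    MeasureTheory.integral_sub_right_eq_self (fun g : ℝ => Real.exp (-1 * g ^ 2)),
    integral_gaussian, div_one, mul_comm]

lemma integrable_exp_neg_sq_add_mul (t : ℝ) :
    MeasureTheory.Integrable fun g : ℝ => Real.exp (-g ^ 2 + g * t) := by
  have h : (fun g : ℝ => Real.exp (-g ^ 2 + g * t)) =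
      fun g => Real.exp (t ^ 2 / 4) * (fun g : ℝ => Real.exp (-1 * g ^ 2)) (g - t / 2) := by
    funext g
    simp only [← Real.exp_add]
    congr 1; ring
  rw [h]
  exact ((integrable_exp_neg_mul_sq one_pos).comp_sub_right (t / 2)).const_mul _

lemma sum_zmod_two_exp (b : ℝ) :
    ∑ a : ZMod 2, Real.exp ((-1) ^ a.val * b) ≤ 2 * Real.exp (b ^ 2 / 2) := by
  have h : ∑ a : ZMod 2, Real.exp ((-1) ^ a.val * b) = 2 * Real.cosh b := by
    rw [show (Finset.univ : Finset (ZMod 2)) = {0, 1} from rfl,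
      Finset.sum_pair (by decide), Real.cosh_eq]
    simp [ZMod.val_one]
    ring
  rw [h]
  linarith [Real.cosh_le_exp_half_sq b]

/-- Exponential moment of a positive semidefinite quadratic form in random signs. -/
lemma sum_exp_quadratic_le {κ ι : Type*} [Fintype κ] [Fintype ι] [DecidableEq ι]
    (a : κ → ι → ℝ)
    (ha : ∀ g : κ → ℝ, ∑ i, (∑ j, g j * a j i) ^ 2 ≤ ∑ j, g j ^ 2) :
    ∑ f : ι → ZMod 2, Real.exp ((∑ j, (∑ i, a j i * (-1) ^ (f i).val) ^ 2) / 4) ≤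
      2 ^ Fintype.card ι * √2 ^ Fintype.card κ := by
  set t : (ι → ZMod 2) → κ → ℝ := fun f j => ∑ i, a j i * (-1) ^ (f i).val with ht
  have hint : ∀ f, MeasureTheory.Integrable
      fun g : κ → ℝ => ∏ j, Real.exp (-g j ^ 2 + g j * t f j) := fun f =>
    MeasureTheory.Integrable.fintype_prod
      (f := fun j (g : ℝ) => Real.exp (-g ^ 2 + g * t f j))
      (fun j => integrable_exp_neg_sq_add_mul _)
  have hF : ∀ f, ∫ g : κ → ℝ, ∏ j, Real.exp (-g j ^ 2 + g j * t f j) =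
      √Real.pi ^ Fintype.card κ * Real.exp ((∑ j, t f j ^ 2) / 4) := by
    intro f
    rw [MeasureTheory.integral_fintype_prod_volume_eq_prod
      (fun j (g : ℝ) => Real.exp (-g ^ 2 + g * t f j))]
    simp_rw [integral_exp_neg_sq_add_mul, Finset.prod_mul_distrib, ← Real.exp_sum,
      Finset.sum_div]
    simp
  have hG : ∫ g : κ → ℝ, ∏ j, Real.exp (-(1 / 2) * g j ^ 2) =
      √Real.pi ^ Fintype.card κ * √2 ^ Fintype.card κ := by
    rw [MeasureTheory.integral_fintype_prod_volume_eq_prod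
      (fun _ (g : ℝ) => Real.exp (-(1 / 2) * g ^ 2))]
    simp_rw [integral_gaussian]
    rw [Finset.prod_const, Finset.card_univ, ← mul_pow, ← Real.sqrt_mul Real.pi_pos.le]
    norm_num
  have hGi : MeasureTheory.Integrable
      fun g : κ → ℝ => ∏ j, Real.exp (-(1 / 2) * g j ^ 2) :=
    MeasureTheory.Integrable.fintype_prod
      (f := fun _ (g : ℝ) => Real.exp (-(1 / 2) * g ^ 2))
      (fun j => integrable_exp_neg_mul_sq (by norm_num))
  -- For fixed `g` the sum over signs factors into terms `2 cosh (b i) ≤ 2 exp (b i² / 2)`. The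
  -- contraction hypothesis `ha` bounds `∑ b i²` by `∑ g j²`, so half of the Gaussian exponent
  -- survives.
  have hpt : ∀ g : κ → ℝ, ∑ f, ∏ j, Real.exp (-g j ^ 2 + g j * t f j) ≤
      2 ^ Fintype.card ι * ∏ j, Real.exp (-(1 / 2) * g j ^ 2) := by
    intro g
    set b : ι → ℝ := fun i => ∑ j, g j * a j i with hb
    have h1 : ∀ f, ∏ j, Real.exp (-g j ^ 2 + g j * t f j) =
        Real.exp (-∑ j, g j ^ 2) * ∏ i, Real.exp ((-1) ^ (f i).val * b i) := by
      intro f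
      rw [← Real.exp_sum, ← Real.exp_sum, ← Real.exp_add, Finset.sum_add_distrib,
        Finset.sum_neg_distrib]
      congr 2
      simp only [ht, hb, Finset.mul_sum]
      rw [Finset.sum_comm]
      exact Finset.sum_congr rfl fun i _ => Finset.sum_congr rfl fun j _ => by ring
    simp_rw [h1]
    rw [← Finset.mul_sum, ← Fintype.prod_sum
      (fun i (c : ZMod 2) => Real.exp ((-1) ^ c.val * b i))]
    calc _ ≤ Real.exp (-∑ j, g j ^ 2) * ∏ i, (2 * Real.exp (b i ^ 2 / 2)) := by
          gcongr with i
          exact sum_zmod_two_exp _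
      _ = 2 ^ Fintype.card ι * Real.exp (-∑ j, g j ^ 2 + (∑ i, b i ^ 2) / 2) := by
          rw [Finset.prod_mul_distrib, ← Real.exp_sum, Real.exp_add, Finset.sum_div]
          simp; ring
      _ ≤ 2 ^ Fintype.card ι * Real.exp (∑ j, -(1 / 2) * g j ^ 2) := by
          gcongr
          rw [← Finset.mul_sum]
          linarith [ha g]
      _ = _ := by rw [Real.exp_sum]
  have key := MeasureTheory.integral_mono
    (MeasureTheory.integrable_finsetSum Finset.univ fun f _ => hint f)
    (hGi.const_mul (2 ^ Fintype.card ι)) hpt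
  rw [MeasureTheory.integral_finsetSum _ fun f _ => hint f,
    MeasureTheory.integral_const_mul, hG] at key
  simp_rw [hF] at key
  rw [← Finset.mul_sum] at key
  have hpi : 0 < √Real.pi ^ Fintype.card κ := by positivity
  refine le_of_mul_le_mul_left (key.trans_eq ?_) hpi
  ring

lemma norm_signVec_sq {X : Type*} [Fintype X] (f : X → ZMod 2) :
    ‖signVec f‖ ^ 2 = Fintype.card X := by
  rw [EuclideanSpace.norm_sq_eq]
  simp [signVec]

/-- The exponential moment of the squared norm of the projection of a random sign vector. -/
lemma sum_exp_inner_le {X : Type*} [Fintype X] [DecidableEq X] {K : ℕ}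
    (u : Fin K → EuclideanSpace ℂ X) (hu : Orthonormal ℂ u) :
    ∑ f : X → ZMod 2, Real.exp ((∑ j, ‖inner ℂ (u j) (signVec f)‖ ^ 2) / 4) ≤
      2 ^ Fintype.card X * 2 ^ K := by
  -- Real and imaginary parts turn the `K` complex functionals into `2K` real ones, and `√2 ^ (2K) =
  -- 2 ^ K`.
  set a : Fin K ⊕ Fin K → X → ℝ :=
    Sum.elim (fun j i => (u j i).re) (fun j i => (u j i).im) with ha
  have h := sum_exp_quadratic_le a (fun g => by
    -- The minus sign makes the real part of `c j * u j i` equal to `g (.inl j) * re + g (.inr j) *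
    -- im`; the contraction property is then orthonormality of `u`.
    set c : Fin K → ℂ := fun j => ⟨g (.inl j), -g (.inr j)⟩ with hc
    have h1 : ‖∑ j, c j • u j‖ ^ 2 = ∑ j, g j ^ 2 := by
      rw [← inner_self_eq_norm_sq (𝕜 := ℂ), hu.inner_sum, Fintype.sum_sum_type,
        ← Finset.sum_add_distrib]
      simp [hc]
      exact Finset.sum_congr rfl fun j _ => by ring
    rw [← h1, EuclideanSpace.norm_sq_eq]
    refine Finset.sum_le_sum fun i _ => ?_
    have h2 : ∑ j, g j * a j i = ((∑ j, c j • u j) i).re := by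
      rw [Fintype.sum_sum_type]
      simp [hc, ha, Finset.sum_add_distrib]
    rw [h2, ← sq_abs]
    gcongr
    exact Complex.abs_re_le_norm _)
  have hcard : √2 ^ Fintype.card (Fin K ⊕ Fin K) = (2 : ℝ) ^ K := by
    rw [Fintype.card_sum, Fintype.card_fin, ← two_mul, pow_mul, Real.sq_sqrt (by norm_num)]
  rw [hcard] at h
  refine le_of_eq_of_le (Finset.sum_congr rfl fun f _ => ?_) h
  congr 2
  rw [Fintype.sum_sum_type, ← Finset.sum_add_distrib]
  refine Finset.sum_congr rfl fun j _ => ?_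
  have hs : ∀ i, (-1 : ℂ) ^ (f i).val = (((-1 : ℝ) ^ (f i).val : ℝ) : ℂ) := by
    intro i; push_cast; rfl
  have h3 : inner ℂ (u j) (signVec f) =
      (⟨∑ i, a (.inl j) i * (-1) ^ (f i).val, -∑ i, a (.inr j) i * (-1) ^ (f i).val⟩ : ℂ) := by
    rw [PiLp.inner_apply]
    apply Complex.ext
    · simp [signVec, hs, ha, -Complex.ofReal_pow, -Complex.ofReal_neg, mul_comm]
    · simp [signVec, hs, ha, -Complex.ofReal_pow, -Complex.ofReal_neg, mul_comm]
  rw [h3, ← Complex.normSq_eq_norm_sq, Complex.normSq_mk]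
  ring

/-- Expanding the square, each coordinate contributes at most `2 ‖c j‖ ‖⟪u j, v⟫‖ - ‖c j‖² ≤ ‖⟪u j,
v⟫‖²`. Thus closeness to a point of the span forces a large projection. -/
lemma norm_sq_sub_le_sum_inner {E : Type*} [NormedAddCommGroup E] [InnerProductSpace ℂ E] {K : ℕ}
    (u : Fin K → E) (hu : Orthonormal ℂ u) (c : Fin K → ℂ) (v : E) :
    ‖v‖ ^ 2 - ‖v - ∑ j, c j • u j‖ ^ 2 ≤ ∑ j, ‖inner ℂ (u j) v‖ ^ 2 := by
  have h1 : ‖∑ j, c j • u j‖ ^ 2 = ∑ j, ‖c j‖ ^ 2 := by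
    rw [← inner_self_eq_norm_sq (𝕜 := ℂ), hu.inner_sum]
    simp [← Complex.normSq_eq_norm_sq, Complex.normSq_apply]
  rw [@norm_sub_sq ℂ, h1, inner_sum]
  simp only [inner_smul_right, map_sum]
  rw [sub_add_eq_sub_sub, sub_sub_cancel, Finset.mul_sum, ← Finset.sum_sub_distrib]
  refine Finset.sum_le_sum fun j _ => ?_
  have h2 : RCLike.re (c j * inner ℂ v (u j)) ≤ ‖c j‖ * ‖inner ℂ (u j) v‖ := by
    rw [← norm_inner_symm v, ← norm_mul]
    exact RCLike.re_le_norm _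
  nlinarith [sq_nonneg (‖c j‖ - ‖inner ℂ (u j) v‖)]

open Classical in
/-- Few sign vectors are close to a given subspace of low dimension. -/
lemma card_signVec_near_le {X : Type*} [Fintype X] [DecidableEq X]
    (W : Submodule ℂ (EuclideanSpace ℂ X)) (δ : ℝ) :
    ((Finset.univ.filter fun f : X → ZMod 2 =>
        ∃ w ∈ W, ‖signVec f - w‖ ^ 2 ≤ δ ^ 2 * Fintype.card X).card : ℝ) *
      Real.exp ((1 - δ ^ 2) * Fintype.card X / 4) ≤
        2 ^ Fintype.card X * 2 ^ Module.finrank ℂ W := by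
  let b := stdOrthonormalBasis ℂ W
  let u : Fin (Module.finrank ℂ W) → EuclideanSpace ℂ X := fun j => b j
  have hu : Orthonormal ℂ u := b.orthonormal.comp_linearIsometry W.subtypeₗᵢ
  refine le_trans ?_ (sum_exp_inner_le u hu)
  rw [← nsmul_eq_mul, ← Finset.sum_const]
  refine le_trans (Finset.sum_le_sum fun f hf => ?_)
    (Finset.sum_le_univ_sum_of_nonneg fun f => (Real.exp_pos _).le)
  obtain ⟨w, hw, hfw⟩ := (Finset.mem_filter.1 hf).2
  have hw' : w = ∑ j, (b.repr ⟨w, hw⟩ j) • u j := by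
    have := congrArg (fun z : W => (z : EuclideanSpace ℂ X)) (b.sum_repr ⟨w, hw⟩)
    simpa [u] using this.symm
  have h := norm_sq_sub_le_sum_inner u hu (fun j => b.repr ⟨w, hw⟩ j) (signVec f)
  rw [← hw', norm_signVec_sq] at h
  gcongr
  linarith

/-! ### Circuits preparing sign states -/

lemma Gate.toMatrix_apply {n : ℕ} (g : Gate n) (x y : Bits n) :
    g.toMatrix x y = if ∀ i, i ∉ g.supp → x i = y i then
      (g.U : Matrix (g.supp → ZMod 2) (g.supp → ZMod 2) ℂ) (fun i => x i) (fun i => y i)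
    else 0 := rfl

lemma Circuit.toMatrix_append {n : ℕ} (V W : Circuit n) :
    Circuit.toMatrix (V ++ W) = Circuit.toMatrix V * Circuit.toMatrix W := by
  simp [Circuit.toMatrix]

lemma Circuit.toMatrix_singleton {n : ℕ} (g : Gate n) : Circuit.toMatrix [g] = g.toMatrix := by
  simp [Circuit.toMatrix]

lemma exists_gate_diagonal {n : ℕ} (s : Finset (Fin n)) (hs : s.card ≤ 2)
    (d : (s → ZMod 2) → ℂ) (hd : ∀ a, ‖d a‖ = 1) :
    ∃ g : Gate n, g.toMatrix = Matrix.diagonal fun x => d fun i => x i := by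
  have hU : Matrix.diagonal d ∈ Matrix.unitaryGroup (s → ZMod 2) ℂ := by
    rw [Matrix.mem_unitaryGroup_iff, Matrix.star_eq_conjTranspose, Matrix.diagonal_conjTranspose,
      Matrix.diagonal_mul_diagonal, ← Matrix.diagonal_one]
    congr 1
    funext a
    simp [Complex.mul_conj, Complex.normSq_eq_norm_sq, hd]
  refine ⟨⟨s, hs, ⟨_, hU⟩⟩, ?_⟩
  ext x y
  rw [Gate.toMatrix_apply, Matrix.diagonal_apply]
  by_cases hxy : x = y
  · subst hxy; simp
  · rw [if_neg hxy]
    split_ifs with h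
    · refine Matrix.diagonal_apply_ne _ fun h' => hxy ?_
      funext i
      by_cases hi : i ∈ s
      · exact congrFun h' ⟨i, hi⟩
      · exact h i hi
    · rfl

/-- The controlled-not map on bit strings. -/
def cnotFun {ι : Type*} [DecidableEq ι] (i j : ι) (x : ι → ZMod 2) : ι → ZMod 2 :=
  Function.update x j (x j + x i)

lemma cnotFun_involutive {ι : Type*} [DecidableEq ι] {i j : ι} (hij : i ≠ j) :
    Function.Involutive (cnotFun (ι := ι) i j) := by
  intro x
  funext k
  by_cases hk : k = j
  · subst hk
    simp [cnotFun, Function.update_of_ne hij, add_assoc, CharTwo.add_self_eq_zero]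
  · simp [cnotFun, hk]

lemma exists_gate_cnot {n : ℕ} {i j : Fin n} (hij : i ≠ j) :
    ∃ g : Gate n, ∀ x y, g.toMatrix x y = if cnotFun i j x = y then 1 else 0 := by
  let s : Finset (Fin n) := {i, j}
  let i' : s := ⟨i, by simp [s]⟩
  let j' : s := ⟨j, by simp [s]⟩
  have hij' : i' ≠ j' := fun h => hij (congrArg Subtype.val h)
  let P : Matrix (s → ZMod 2) (s → ZMod 2) ℂ :=
    Matrix.of fun a b => if cnotFun i' j' a = b then 1 else 0
  have hP : P ∈ Matrix.unitaryGroup (s → ZMod 2) ℂ := by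
    rw [Matrix.mem_unitaryGroup_iff]
    ext a b
    simp only [Matrix.mul_apply, Matrix.star_apply, P, Matrix.of_apply, ite_mul, one_mul, zero_mul,
      Finset.sum_ite_eq, Finset.mem_univ, if_true, Matrix.one_apply]
    simp only [(cnotFun_involutive hij').injective.eq_iff, eq_comm (a := b)]
    split_ifs <;> simp
  refine ⟨⟨s, Finset.card_le_two, ⟨P, hP⟩⟩, fun x y => ?_⟩
  have h1 : (∀ k, k ∉ s → x k = y k) ∧ cnotFun i' j' (fun k : s => x k) = (fun k : s => y k) ↔
      cnotFun i j x = y := by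
    have hres : ∀ k : s, cnotFun i' j' (fun k : s => x k) k = cnotFun i j x k := by
      intro k
      by_cases hk : k = j'
      · subst hk; simp [cnotFun, i', j']
      · have hk' : (k : Fin n) ≠ j := fun h => hk (Subtype.ext h)
        simp [cnotFun, hk, hk']
    have hout : ∀ k, k ∉ s → cnotFun i j x k = x k := by
      intro k hk
      have : k ≠ j := fun h => hk (by simp [s, h])
      simp [cnotFun, this]
    constructor
    · rintro ⟨h1, h2⟩
      funext k
      by_cases hk : k ∈ s
      · rw [← hres ⟨k, hk⟩, h2]
      · rw [hout k hk, h1 k hk]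
    · rintro rfl
      exact ⟨fun k hk => (hout k hk).symm, funext hres⟩
  rw [Gate.toMatrix_apply]
  simp only [P, Matrix.of_apply]
  rw [← ite_and]
  exact if_congr h1 rfl rfl

/-- Conjugating by a controlled-not with target `j` and control `i` replaces `x j` by `x j + x i`,
so every further bit of the parity costs two gates around a single phase gate on `j`. -/
lemma exists_circuit_parity_insert {n : ℕ} (θ : ℝ) (j : Fin n) (L : Finset (Fin n)) :
    j ∉ L → ∃ V : Circuit n, V.length = 2 * L.card + 1 ∧ Circuit.toMatrix V =
      Matrix.diagonal fun x =>
        Complex.exp ((θ * (-1) ^ (x j + ∑ i ∈ L, x i).val : ℝ) * Complex.I) := by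
  induction L using Finset.induction_on with
  | empty =>
    intro _
    obtain ⟨g, hg⟩ := exists_gate_diagonal {j} (by simp)
      (fun a => Complex.exp ((θ * (-1) ^ (a ⟨j, by simp⟩).val : ℝ) * Complex.I))
      (fun a => Complex.norm_exp_ofReal_mul_I _)
    exact ⟨[g], rfl, by simpa [Circuit.toMatrix_singleton] using hg⟩
  | insert i L hi ih =>
    intro hj
    rw [Finset.mem_insert, not_or] at hj
    obtain ⟨V, hV, hVm⟩ := ih hj.2
    obtain ⟨g, hg⟩ := exists_gate_cnot (Ne.symm hj.1)
    refine ⟨[g] ++ V ++ [g], by simp [hV, Finset.card_insert_of_notMem hi]; ring, ?_⟩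
    rw [Circuit.toMatrix_append, Circuit.toMatrix_append, Circuit.toMatrix_singleton, hVm]
    ext x y
    simp only [Matrix.mul_apply, hg, ite_mul, one_mul, zero_mul,
      Finset.sum_ite_eq, Finset.mem_univ, if_true, Matrix.diagonal_apply]
    have hL : ∑ k ∈ L, cnotFun i j x k = ∑ k ∈ L, x k := by
      refine Finset.sum_congr rfl fun k hk => ?_
      have : k ≠ j := fun h => hj.2 (h ▸ hk)
      simp [cnotFun, this]
    have hxj : cnotFun i j x j = x j + x i := by simp [cnotFun]
    rw [cnotFun_involutive (Ne.symm hj.1), hL, hxj, Finset.sum_insert hi, add_assoc]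
    split_ifs <;> simp

lemma exists_circuit_parity {n : ℕ} (θ : ℝ) (S : Finset (Fin n)) :
    ∃ V : Circuit n, V.length ≤ 2 * S.card + 1 ∧ Circuit.toMatrix V =
      Matrix.diagonal fun x =>
        Complex.exp ((θ * (-1) ^ (∑ i ∈ S, x i).val : ℝ) * Complex.I) := by
  rcases S.eq_empty_or_nonempty with rfl | ⟨j, hj⟩
  · obtain ⟨g, hg⟩ := exists_gate_diagonal (n := n) ∅ (by simp)
      (fun _ => Complex.exp ((θ : ℝ) * Complex.I)) (fun a => Complex.norm_exp_ofReal_mul_I _)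
    exact ⟨[g], le_rfl, by simpa [Circuit.toMatrix_singleton] using hg⟩
  · obtain ⟨V, hV, hVm⟩ := exists_circuit_parity_insert θ j (S.erase j) (by simp)
    refine ⟨V, by rw [hV]; have := Finset.card_erase_le (s := S) (a := j); omega, ?_⟩
    simpa only [Finset.add_sum_erase S _ hj] using hVm

lemma exists_circuit_sum_parity {n k : ℕ} (F : Finset (Finset (Fin n)))
    (hF : ∀ S ∈ F, S.card ≤ k) (c : Finset (Fin n) → ℝ) :
    ∃ V : Circuit n, V.length ≤ F.card * (2 * k + 1) ∧ Circuit.toMatrix V =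
      Matrix.diagonal fun x =>
        Complex.exp ((∑ S ∈ F, c S * (-1) ^ (∑ i ∈ S, x i).val : ℝ) * Complex.I) := by
  induction F using Finset.induction_on with
  | empty => exact ⟨[], by simp, by simp [Circuit.toMatrix]⟩
  | insert S F hS ih =>
    obtain ⟨V, hV, hVm⟩ := ih fun T hT => hF T (Finset.mem_insert_of_mem hT)
    obtain ⟨W, hW, hWm⟩ := exists_circuit_parity (c S) S
    have := hF S (Finset.mem_insert_self _ _)
    refine ⟨W ++ V, ?_, ?_⟩
    · rw [List.length_append, Finset.card_insert_of_notMem hS]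
      nlinarith
    · rw [Circuit.toMatrix_append, hWm, hVm, Matrix.diagonal_mul_diagonal]
      congr 1
      funext x
      rw [← Complex.exp_add, Finset.sum_insert hS, Complex.ofReal_add, add_mul]

lemma neg_one_pow_val_add (a b : ZMod 2) :
    (-1 : ℝ) ^ (a + b).val = (-1) ^ a.val * (-1) ^ b.val := by
  rw [ZMod.val_add, neg_one_pow_eq_pow_mod_two, Nat.mod_mod, ← neg_one_pow_eq_pow_mod_two, pow_add]

lemma neg_one_pow_val_sum {ι : Type*} (S : Finset ι) (x : ι → ZMod 2) :
    (-1 : ℝ) ^ (∑ i ∈ S, x i).val = ∏ i ∈ S, (-1) ^ (x i).val := by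
  classical
  induction S using Finset.induction_on with
  | empty => simp
  | insert i S hi ih => rw [Finset.sum_insert hi, Finset.prod_insert hi, neg_one_pow_val_add, ih]

/-- The Walsh expansion of a real function of bits. -/
lemma exists_walsh_expansion {m : ℕ} (f : Bits m → ℝ) :
    ∃ c : Finset (Fin m) → ℝ, ∀ x, f x = ∑ S, c S * (-1) ^ (∑ i ∈ S, x i).val := by
  refine ⟨fun S => ∑ y, f y * ((1 / 2) ^ m * (-1) ^ (∑ i ∈ S, y i).val), fun x => ?_⟩
  have hδ : ∀ y : Bits m, ∑ S : Finset (Fin m),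
      ((1 / 2) ^ m * (-1) ^ (∑ i ∈ S, y i).val) * (-1 : ℝ) ^ (∑ i ∈ S, x i).val =
        if y = x then 1 else 0 := by
    intro y
    have h1 : ∀ S : Finset (Fin m),
        ((1 / 2) ^ m * (-1) ^ (∑ i ∈ S, y i).val) * (-1 : ℝ) ^ (∑ i ∈ S, x i).val =
          (1 / 2) ^ m * ∏ i ∈ S, (-1) ^ (y i + x i).val := by
      intro S
      rw [neg_one_pow_val_sum, neg_one_pow_val_sum, mul_assoc, ← Finset.prod_mul_distrib]
      simp_rw [neg_one_pow_val_add]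
    simp_rw [h1]
    -- Orthogonality of characters: the sum over `S` is `∏ (1 + (-1)^(y i + x i))`, whose factors
    -- are all `2` if `y = x` and include a zero otherwise.
    rw [← Finset.mul_sum, ← Finset.powerset_univ, ← Finset.prod_one_add]
    split_ifs with h
    · subst h
      simp only [CharTwo.add_self_eq_zero, ZMod.val_zero, pow_zero, Finset.prod_const,
        Finset.card_univ, Fintype.card_fin, ← mul_pow]
      norm_num
    · obtain ⟨i, hi⟩ := Function.ne_iff.1 h
      rw [Finset.prod_eq_zero (Finset.mem_univ i), mul_zero]
      have h2 : y i + x i = 1 := by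
        generalize y i = a at *
        generalize x i = b at *
        revert a b; decide
      rw [h2, ZMod.val_one]; norm_num
  simp_rw [Finset.sum_mul]
  rw [Finset.sum_comm]
  simp only [mul_assoc (f _), ← Finset.mul_sum, hδ]
  simp

/-- Diagonal sign operators controlled by `m` of the `n` qubits. -/
lemma exists_circuit_sign {n m : ℕ} (e : Fin m ↪ Fin n) (f : Bits m → ZMod 2) :
    ∃ V : Circuit n, V.length ≤ 2 ^ m * (2 * m + 1) ∧ Circuit.toMatrix V =
      Matrix.diagonal fun x => (-1 : ℂ) ^ (f fun i => x (e i)).val := by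
  -- The sign is `exp (iπ f)`, so the expansion of the real function `π f` gives the angles of the
  -- parity phases.
  obtain ⟨c, hc⟩ := exists_walsh_expansion fun x => Real.pi * ((f x).val : ℝ)
  let E : Finset (Fin m) ↪ Finset (Fin n) := (Finset.mapEmbedding e).toEmbedding
  obtain ⟨V, hV, hVm⟩ := exists_circuit_sum_parity (k := m) (Finset.univ.map E)
    (fun S hS => by
      obtain ⟨T, -, rfl⟩ := Finset.mem_map.1 hS
      simpa [E] using Finset.card_le_univ T) (fun S => c (Function.invFun E S))
  refine ⟨V, by simpa using hV, ?_⟩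
  rw [hVm]
  congr 1
  funext x
  have h : ∑ S ∈ Finset.univ.map E, c (Function.invFun E S) * (-1 : ℝ) ^ (∑ i ∈ S, x i).val =
      Real.pi * ((f fun i => x (e i)).val : ℝ) := by
    rw [hc, Finset.sum_map]
    refine Finset.sum_congr rfl fun S _ => ?_
    rw [Function.leftInverse_invFun E.injective]
    simp [E]
  rw [h]
  push_cast
  rw [mul_comm (Real.pi : ℂ), mul_assoc, Complex.exp_nat_mul, Complex.exp_pi_mul_I]

lemma exists_gate_hadamard {n : ℕ} (i : Fin n) :
    ∃ g : Gate n, ∀ x y, g.toMatrix x y = if ∀ k, k ≠ i → x k = y k then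
      (1 / √2 : ℝ) * (-1 : ℂ) ^ (x i * y i).val else 0 := by
  let s : Finset (Fin n) := {i}
  let i' : s := ⟨i, by simp [s]⟩
  let _ : Unique s := ⟨⟨i'⟩, fun k => Subtype.ext (Finset.mem_singleton.1 k.2)⟩
  let H : Matrix (s → ZMod 2) (s → ZMod 2) ℂ :=
    Matrix.of fun a b => (1 / √2 : ℝ) * (-1 : ℂ) ^ (a i' * b i').val
  have hH : H ∈ Matrix.unitaryGroup (s → ZMod 2) ℂ := by
    rw [Matrix.mem_unitaryGroup_iff]
    ext a b
    have h2 : ((√2 : ℝ) : ℂ)⁻¹ * ((√2 : ℝ) : ℂ)⁻¹ = 1 / 2 := by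
      rw [← mul_inv, ← Complex.ofReal_mul, Real.mul_self_sqrt (by norm_num)]
      norm_num
    have hab : a = b ↔ a i' = b i' :=
      ⟨fun h => h ▸ rfl, fun h => funext fun k => by rw [Subsingleton.elim k i']; exact h⟩
    have hsum : ∀ F : (s → ZMod 2) → ℂ, ∑ c, F c = F (fun _ => 0) + F (fun _ => 1) := by
      intro F
      rw [← (Equiv.funUnique s (ZMod 2)).symm.sum_comp]
      exact Fin.sum_univ_two (fun c : ZMod 2 => F (fun _ => c))
    rw [Matrix.mul_apply, hsum, Matrix.one_apply]
    simp only [H, Matrix.star_apply, Matrix.of_apply, hab]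
    generalize a i' = p
    generalize b i' = q
    have hp : p = 0 ∨ p = 1 := by revert p; decide
    have hq : q = 0 ∨ q = 1 := by revert q; decide
    rcases hp with rfl | rfl <;> rcases hq with rfl | rfl <;>
      simp [ZMod.val_one, h2] <;> norm_num
  refine ⟨⟨s, by simp [s], ⟨H, hH⟩⟩, fun x y => ?_⟩
  rw [Gate.toMatrix_apply]
  simp [H, s, i']

lemma exists_circuit_uniform {n : ℕ} (S : Finset (Fin n)) :
    ∃ V : Circuit n, V.length = S.card ∧
      (Circuit.toMatrix V).mulVec (WithLp.ofLp (ketZero n)) =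
        fun x => if ∀ i, i ∉ S → x i = 0 then ((1 / √2 : ℝ) : ℂ) ^ S.card else 0 := by
  induction S using Finset.induction_on with
  | empty =>
    refine ⟨[], rfl, ?_⟩
    funext x
    simp only [Circuit.toMatrix, List.map_nil, List.prod_nil, Matrix.one_mulVec, ketZero,
      PiLp.ofLp_single, Pi.single_apply, funext_iff]
    simp
  | insert i S hi ih =>
    obtain ⟨V, hV, hVm⟩ := ih
    obtain ⟨g, hg⟩ := exists_gate_hadamard i
    refine ⟨[g] ++ V, by simp [hV, Finset.card_insert_of_notMem hi], ?_⟩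
    rw [Circuit.toMatrix_append, ← Matrix.mulVec_mulVec, hVm, Circuit.toMatrix_singleton]
    funext x
    -- Qubit `i` is still zero before its Hadamard gate, so only the input string with `i`-th bit
    -- zero contributes.
    rw [Matrix.mulVec, dotProduct, Finset.sum_eq_single (Function.update x i 0)]
    · have h1 : ∀ k, k ≠ i → x k = Function.update x i 0 k := fun k hk => by simp [hk]
      have h2 : (∀ k, k ∉ S → Function.update x i 0 k = 0) ↔ ∀ k, k ∉ insert i S → x k = 0 := by
        constructor
        · intro h k hk
          rw [Finset.mem_insert, not_or] at hk
          simpa [hk.1] using h k hk.2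
        · intro h k hk
          by_cases hki : k = i
          · simp [hki]
          · simpa [hki] using h k (by simp [hki, hk])
      simp only [hg, if_pos h1, h2, Finset.card_insert_of_notMem hi, pow_succ]
      split_ifs <;> simp [mul_comm]
    · intro y _ hy
      rw [hg]
      by_cases hyi : y i = 0
      · rw [if_neg, zero_mul]
        refine fun h => hy (funext fun k => ?_)
        by_cases hk : k = i
        · subst hk; simpa using hyi
        · simp [hk, h k hk]
      · rw [if_neg (c := ∀ k, k ∉ S → y k = 0) fun h => hyi (h i hi), mul_zero]
    · simp

/-- Preparation of the sign state of `f` on the qubits in the range of `e`. -/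
lemma exists_circuit_output_sign {n m : ℕ} (e : Fin m ↪ Fin n) (f : Bits m → ZMod 2) :
    ∃ V : Circuit n, V.length ≤ 2 ^ m * (2 * m + 1) + m ∧
      ∀ x, Circuit.output V x = if ∀ i, i ∉ Set.range e → x i = 0 then
        ((1 / √2 : ℝ) : ℂ) ^ m * (-1 : ℂ) ^ (f fun i => x (e i)).val else 0 := by
  obtain ⟨V, hV, hVm⟩ := exists_circuit_sign e f
  obtain ⟨W, hW, hWm⟩ := exists_circuit_uniform (Finset.univ.map e)
  rw [Finset.card_map, Finset.card_univ, Fintype.card_fin] at hW hWm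
  refine ⟨V ++ W, by rw [List.length_append]; omega, fun x => ?_⟩
  rw [Circuit.output, Circuit.toMatrix_append, ← Matrix.mulVec_mulVec, hWm, hVm]
  simp only [Matrix.mulVec_diagonal]
  have h : (∀ i, i ∉ Finset.univ.map e → x i = 0) ↔ ∀ i, i ∉ Set.range e → x i = 0 := by
    simp
  simp only [h]
  rw [mul_comm, ite_mul, zero_mul]

/-! ### Restriction of stabilizer states to a subset of the qubits -/

/-- Parameters of an unnormalized stabilizer state: linear equations for its support, and the
coefficients of the linear and of the quadratic function in its phases. -/
abbrev StabParam (m : ℕ) : Type :=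
  (Fin m → Bits m) × Bits m × Bits m × (Fin m → Bits m) × Bits m

/-- The unnormalized stabilizer state with given parameters. -/
noncomputable def stabFun {m : ℕ} (p : StabParam m) : QState m :=
  WithLp.toLp 2 fun x =>
    if Matrix.mulVec (Matrix.of p.1) x = p.2.1 then
      Complex.I ^ (dotProduct p.2.2.1 x).val *
        (-1 : ℂ) ^ (dotProduct x (Matrix.mulVec (Matrix.of p.2.2.2.1) x) +
          dotProduct p.2.2.2.2 x).val
    else 0

/-- The extension of bit strings by zeros. -/
noncomputable abbrev extendBits {m n : ℕ} (e : Fin m ↪ Fin n) : Bits m →ₗ[ZMod 2] Bits n :=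
  Function.ExtendByZero.linearMap (ZMod 2) e

lemma extendBits_injective {m n : ℕ} (e : Fin m ↪ Fin n) :
    Function.Injective (extendBits e) := by
  intro x y h
  funext i
  have := congrFun h (e i)
  simpa [e.injective.extend_apply] using this

/-- Restriction of a vector to the subspace where the qubits outside the range of `e` are zero. -/
noncomputable def restrictState {m n : ℕ} (e : Fin m ↪ Fin n) : QState n →ₗ[ℂ] QState m where
  toFun φ := WithLp.toLp 2 fun y => φ (extendBits e y)
  map_add' _ _ := rfl
  map_smul' _ _ := rfl

lemma restrictState_apply {m n : ℕ} (e : Fin m ↪ Fin n) (φ : QState n) (y : Bits m) :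
    restrictState e φ y = φ (extendBits e y) := rfl

lemma norm_restrictState_le {m n : ℕ} (e : Fin m ↪ Fin n) (φ : QState n) :
    ‖restrictState e φ‖ ≤ ‖φ‖ := by
  refine le_of_sq_le_sq ?_ (norm_nonneg _)
  rw [EuclideanSpace.norm_sq_eq, EuclideanSpace.norm_sq_eq]
  simp_rw [restrictState_apply]
  rw [← Finset.sum_image (f := fun x => ‖φ x‖ ^ 2) (s := Finset.univ) (g := extendBits e)
    (fun _ _ _ _ h => extendBits_injective e h)]
  exact Finset.sum_le_univ_sum_of_nonneg fun x => by positivity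

/-- Subtracting a linear projection onto the direction gives a map `R` whose kernel is the
direction. Using `m` equations, possibly redundant, gives all dimensions one parameter space. -/
lemma exists_matrix_mem_affineSubspace_iff {m : ℕ} (A : AffineSubspace (ZMod 2) (Bits m))
    (hA : (A : Set (Bits m)).Nonempty) :
    ∃ (R : Fin m → Bits m) (q : Bits m), ∀ x, x ∈ A ↔ Matrix.mulVec (Matrix.of R) x = q := by
  obtain ⟨p, hp⟩ := hA
  obtain ⟨g, hg⟩ := A.direction.subtype.exists_leftInverse_of_injective
    (by simp)
  let R : Bits m →ₗ[ZMod 2] Bits m := LinearMap.id - A.direction.subtype ∘ₗ g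
  have hR : ∀ v, R v = 0 ↔ v ∈ A.direction := by
    intro v
    constructor
    · intro h
      have : v = g v := by simpa [R, sub_eq_zero] using h
      rw [this]; exact (g v).2
    · intro h
      have := congrArg Subtype.val (LinearMap.congr_fun hg ⟨v, h⟩)
      simp only [LinearMap.comp_apply, Submodule.subtype_apply, LinearMap.id_apply] at this
      simp [R, this]
  refine ⟨LinearMap.toMatrix' R, R p, fun x => ?_⟩
  rw [← AffineSubspace.vsub_right_mem_direction_iff_mem hp, vsub_eq_sub, ← hR, map_sub, sub_eq_zero]
  exact (Eq.congr_left (LinearMap.toMatrix'_mulVec R x)).symm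

open Matrix in
lemma IsQuadratic.comp_linearMap {m n : ℕ} {Q : Bits n → ZMod 2} (hQ : IsQuadratic Q)
    (f : Bits m →ₗ[ZMod 2] Bits n) : IsQuadratic fun x => Q (f x) := by
  obtain ⟨B, a, h⟩ := hQ
  refine ⟨(LinearMap.toMatrix' f)ᵀ * B * LinearMap.toMatrix' f, a ᵥ* LinearMap.toMatrix' f,
    fun x => ?_⟩
  dsimp only
  rw [h, ← LinearMap.toMatrix'_mulVec f x]
  congr 1
  · rw [← Matrix.mulVec_mulVec, ← Matrix.mulVec_mulVec, Matrix.dotProduct_mulVec x,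
      Matrix.vecMul_transpose]
  · rw [Matrix.dotProduct_mulVec]

/-- Affine supports and quadratic phases pull back along the linear map `extendBits e`. The scalar
absorbs the normalization, and is zero when the support is missed. -/
lemma exists_restrictState_eq_smul_stabFun {m n : ℕ} (e : Fin m ↪ Fin n) {s : QState n}
    (hs : s ∈ Stab n) : ∃ (c : ℂ) (p : StabParam m), restrictState e s = c • stabFun p := by
  obtain ⟨A, l, Q, -, hQ, rfl⟩ := hs
  obtain ⟨B, a, hBa⟩ := hQ.comp_linearMap (extendBits e)
  let A' : AffineSubspace (ZMod 2) (Bits m) := A.comap (extendBits e).toAffineMap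
  have hA' : ∀ y, extendBits e y ∈ A ↔ y ∈ A' := fun y => Iff.rfl
  by_cases hne : (A' : Set (Bits m)).Nonempty
  · obtain ⟨R, q, hR⟩ := exists_matrix_mem_affineSubspace_iff A' hne
    let b : Bits m := fun i => l (extendBits e (Pi.single i 1))
    have hb : ∀ y, l (extendBits e y) = dotProduct b y := by
      intro y
      have := LinearMap.pi_apply_eq_sum_univ (l ∘ₗ extendBits e) y
      simp only [LinearMap.comp_apply, smul_eq_mul] at this
      rw [this, dotProduct]
      refine Finset.sum_congr rfl fun i _ => ?_
      rw [mul_comm]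
      congr 3
      funext j
      simp [Pi.single_apply, eq_comm]
    refine ⟨1 / (Real.sqrt (Nat.card A) : ℂ), (R, q, b, B, a), ?_⟩
    ext y
    rw [restrictState_apply, PiLp.smul_apply]
    simp only [stabVector, stabFun, hA', hR, hb, hBa, smul_eq_mul, mul_ite, mul_zero, mul_assoc]
    rfl
  · refine ⟨0, default, ?_⟩
    ext y
    rw [restrictState_apply, zero_smul]
    simp only [stabVector]
    rw [if_neg]
    · rfl
    · exact fun h => hne ⟨y, h⟩

lemma card_stabParam (m : ℕ) : Fintype.card (StabParam m) = 2 ^ (2 * m ^ 2 + 3 * m) := by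
  simp only [Fintype.card_prod, Fintype.card_pi, ZMod.card, Finset.prod_const, Finset.card_univ,
    Fintype.card_fin]
  ring

/-! ### The stabilizer rank -/

lemma single_mem_stab {n : ℕ} (x : Bits n) : EuclideanSpace.single x (1 : ℂ) ∈ Stab n := by
  refine ⟨affineSpan (ZMod 2) {x}, 0, fun _ => 0, by simp, ⟨0, 0, by simp⟩, ?_⟩
  ext y
  simp [stabVector, AffineSubspace.mem_affineSpan_singleton]

lemma stabRank_spec {n : ℕ} (φ : QState n) :
    0 < stabRank φ ∧ ∃ (c : Fin (stabRank φ) → ℂ) (s : Fin (stabRank φ) → QState n),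
      (∀ i, s i ∈ Stab n) ∧ φ = ∑ i, c i • s i := by
  refine Nat.sInf_mem (s := {M : ℕ | 0 < M ∧ ∃ (c : Fin M → ℂ) (s : Fin M → QState n),
    (∀ i, s i ∈ Stab n) ∧ φ = ∑ i, c i • s i}) ?_
  let eqv := Fintype.equivFin (Bits n)
  refine ⟨Fintype.card (Bits n), Fintype.card_pos, fun i => φ (eqv.symm i),
    fun i => EuclideanSpace.single (eqv.symm i) 1, fun i => single_mem_stab _, ?_⟩
  rw [eqv.symm.sum_comp fun x => φ x • EuclideanSpace.single x (1 : ℂ)]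
  ext y
  simp [Pi.single_apply]

lemma approxStabRank_spec {n : ℕ} {δ : ℝ} (hδ : 0 ≤ δ) (φ : QState n) :
    ∃ ψ : QState n, ‖φ - ψ‖ ≤ δ ∧ stabRank ψ = approxStabRank δ φ :=
  Nat.sInf_mem (s := {m : ℕ | ∃ ψ : QState n, ‖φ - ψ‖ ≤ δ ∧ stabRank ψ = m})
    ⟨_, φ, by simpa using hδ, rfl⟩

lemma approxStabRank_le_stabRank {n : ℕ} {δ : ℝ} (hδ : 0 ≤ δ) (φ : QState n) :
    approxStabRank δ φ ≤ stabRank φ :=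
  Nat.sInf_le ⟨φ, by simpa using hδ, rfl⟩

lemma approxStabRank_pos {n : ℕ} {δ : ℝ} (hδ : 0 ≤ δ) (φ : QState n) :
    0 < approxStabRank δ φ := by
  obtain ⟨ψ, -, h⟩ := approxStabRank_spec hδ φ
  exact h ▸ (stabRank_spec ψ).1

/-! ### The union bound and hard circuits -/

/-- The span of the stabilizer states with given parameters. -/
noncomputable def stabSpan {m M : ℕ} (t : Fin M → StabParam m) : Submodule ℂ (QState m) :=
  Submodule.span ℂ (Set.range fun i => stabFun (t i))

lemma finrank_stabSpan_le {m M : ℕ} (t : Fin M → StabParam m) :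
    Module.finrank ℂ (stabSpan t) ≤ M := by
  have h := finrank_range_le_card (R := ℂ) fun i => stabFun (t i)
  rwa [Fintype.card_fin] at h

lemma exists_restrictState_mem_stabSpan {m n M : ℕ} (e : Fin m ↪ Fin n) (ψ : QState n)
    (h : stabRank ψ ≤ M) : ∃ t : Fin M → StabParam m, restrictState e ψ ∈ stabSpan t := by
  obtain ⟨-, c, s, hs, hψ⟩ := stabRank_spec ψ
  choose c' p hp using fun i => exists_restrictState_eq_smul_stabFun e (hs i)
  -- Padding with arbitrary parameters only enlarges the span, so counting tuples of length exactly
  -- `M` suffices.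
  refine ⟨fun j => if hj : (j : ℕ) < stabRank ψ then p ⟨j, hj⟩ else default, ?_⟩
  have hres : restrictState e ψ = ∑ i, restrictState e (c i • s i) := by
    rw [← map_sum, ← hψ]
  rw [hres]
  refine Submodule.sum_mem _ fun i _ => ?_
  rw [map_smul, hp]
  refine Submodule.smul_mem _ _ (Submodule.smul_mem _ _ (Submodule.subset_span ?_))
  exact ⟨⟨i, i.2.trans_le h⟩, by simp⟩

/-- Some sign vector is far from all spans of few stabilizer states. -/
lemma exists_signVec_far {m M : ℕ} {δ : ℝ} (hm : 1 ≤ m)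
    (h : 24 * (m : ℝ) ^ 2 * M < (1 - δ ^ 2) * 2 ^ m) :
    ∃ f : Bits m → ZMod 2, ∀ t : Fin M → StabParam m, ∀ w ∈ stabSpan t,
      δ ^ 2 * 2 ^ m < ‖signVec f - w‖ ^ 2 := by
  classical
  by_contra! hcon
  have hX : Fintype.card (Bits m) = 2 ^ m := by simp
  let bad : (Fin M → StabParam m) → Finset (Bits m → ZMod 2) := fun t =>
    Finset.univ.filter fun f =>
      ∃ w ∈ stabSpan t, ‖signVec f - w‖ ^ 2 ≤ δ ^ 2 * Fintype.card (Bits m)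
  have hcover : (Finset.univ : Finset (Bits m → ZMod 2)) ⊆ Finset.univ.biUnion bad := by
    intro f _
    obtain ⟨t, w, hw, hf⟩ := hcon f
    refine Finset.mem_biUnion.2 ⟨t, Finset.mem_univ _, Finset.mem_filter.2 ⟨Finset.mem_univ _, w,
      hw, ?_⟩⟩
    rw [hX]
    exact_mod_cast hf
  set N := Fintype.card (Bits m) with hN
  have hbad : ∀ t, ((bad t).card : ℝ) * Real.exp ((1 - δ ^ 2) * N / 4) ≤ 2 ^ N * 2 ^ M := by
    intro t
    refine (card_signVec_near_le (stabSpan t) δ).trans ?_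
    gcongr
    · norm_num
    · exact finrank_stabSpan_le t
  have hcard : (2 : ℝ) ^ N ≤ ∑ t, ((bad t).card : ℝ) := by
    have := (Finset.card_le_card hcover).trans Finset.card_biUnion_le
    rw [Finset.card_univ, Fintype.card_fun, ZMod.card] at this
    exact_mod_cast this
  have h1 : (2 : ℝ) ^ N * Real.exp ((1 - δ ^ 2) * N / 4) ≤
      2 ^ N * (2 ^ ((2 * m ^ 2 + 3 * m) * M) * 2 ^ M) := by
    calc _ ≤ (∑ t, ((bad t).card : ℝ)) * Real.exp ((1 - δ ^ 2) * N / 4) := by gcongr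
      _ ≤ ∑ _t : Fin M → StabParam m, (2 : ℝ) ^ N * 2 ^ M := by
        rw [Finset.sum_mul]
        exact Finset.sum_le_sum fun t _ => hbad t
      _ = _ := by
        rw [Finset.sum_const, Finset.card_univ, Fintype.card_fun, card_stabParam, Fintype.card_fin,
          nsmul_eq_mul]
        push_cast
        ring
  have h2 := le_of_mul_le_mul_left h1 (by positivity)
  have h3 : (2 : ℝ) ^ ((2 * m ^ 2 + 3 * m) * M) * 2 ^ M ≤ Real.exp (6 * m ^ 2 * M) := by
    -- The left side is the number of parameter bits plus the dimension bound. The `24` of the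
    -- hypothesis is this `6` times the `4` in the exponential moment.
    have h4 : (2 * m ^ 2 + 3 * m) * M + M ≤ 6 * m ^ 2 * M := by
      have : 2 * m ^ 2 + 3 * m + 1 ≤ 6 * m ^ 2 := by nlinarith
      nlinarith
    calc _ = (2 : ℝ) ^ ((2 * m ^ 2 + 3 * m) * M + M) := by rw [pow_add]
      _ ≤ 2 ^ (6 * m ^ 2 * M) := pow_le_pow_right₀ (by norm_num) h4
      _ ≤ Real.exp 1 ^ (6 * m ^ 2 * M) := by
        gcongr
        linarith [Real.add_one_le_exp 1]
      _ = _ := by rw [← Real.exp_nat_mul]; push_cast; ring_nf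
  have h5 := Real.exp_le_exp.1 (h2.trans h3)
  rw [hX] at h5
  push_cast at h5
  linarith

/-- Some sign state on `m` of the `n` qubits has large approximate stabilizer rank. -/
lemma exists_sign_approxStabRank {n m M : ℕ} (e : Fin m ↪ Fin n) {δ : ℝ} (hδ : 0 ≤ δ) (hm : 1 ≤ m)
    (h : 24 * (m : ℝ) ^ 2 * M < (1 - δ ^ 2) * 2 ^ m) :
    ∃ f : Bits m → ZMod 2, ∀ φ : QState n,
      restrictState e φ = ((1 / √2 : ℝ) : ℂ) ^ m • signVec f → M ≤ approxStabRank δ φ := by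
  obtain ⟨f, hf⟩ := exists_signVec_far hm h
  refine ⟨f, fun φ hφ => ?_⟩
  by_contra! hlt
  obtain ⟨ψ, hψ, hr⟩ := approxStabRank_spec hδ φ
  obtain ⟨t, ht⟩ := exists_restrictState_mem_stabSpan e ψ (hr.trans_lt hlt).le
  have h1 := hf t _ ((stabSpan t).smul_mem (((√2 : ℝ) : ℂ) ^ m) ht)
  have h2 : signVec f = ((√2 : ℝ) : ℂ) ^ m • restrictState e φ := by
    rw [hφ, smul_smul, ← mul_pow, ← Complex.ofReal_mul, mul_one_div_cancel (by positivity)]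
    simp
  rw [h2, ← smul_sub, ← map_sub, norm_smul, mul_pow, norm_pow, Complex.norm_real, ← pow_mul,
    mul_comm m, pow_mul, Real.norm_eq_abs, sq_abs, Real.sq_sqrt (by norm_num)] at h1
  have h3 : ‖restrictState e (φ - ψ)‖ ^ 2 ≤ δ ^ 2 := by
    gcongr
    exact (norm_restrictState_le e _).trans hψ
  have h4 : (0 : ℝ) < 2 ^ m := by positivity
  nlinarith

/-- A circuit on `n` qubits preparing a unit vector of large approximate stabilizer rank. -/
lemma exists_circuit_approxStabRank {n m M : ℕ} (hmn : m ≤ n) {δ : ℝ} (hδ : 0 ≤ δ) (hm : 1 ≤ m)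
    (h : 24 * (m : ℝ) ^ 2 * M < (1 - δ ^ 2) * 2 ^ m) :
    ∃ V : Circuit n, V.length ≤ 2 ^ m * (2 * m + 1) + m ∧ ‖Circuit.output V‖ = 1 ∧
      M ≤ approxStabRank δ (Circuit.output V) := by
  let e : Fin m ↪ Fin n := Fin.castLEEmb hmn
  obtain ⟨f, hf⟩ := exists_sign_approxStabRank e hδ hm h
  obtain ⟨V, hV, hout⟩ := exists_circuit_output_sign e f
  have hext : ∀ y i, extendBits e y (e i) = y i := fun y i => e.injective.extend_apply _ _ _
  have hres : restrictState e (Circuit.output V) = ((1 / √2 : ℝ) : ℂ) ^ m • signVec f := by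
    ext y
    rw [restrictState_apply, hout, if_pos]
    · simp only [hext]; rfl
    · exact fun i hi => Function.extend_apply' _ _ _ (by simpa using hi)
  refine ⟨V, hV, ?_, hf _ hres⟩
  -- The output vanishes off the range of `extendBits e`, so restriction loses no norm.
  have hnorm : ‖Circuit.output V‖ ^ 2 = ‖restrictState e (Circuit.output V)‖ ^ 2 := by
    rw [EuclideanSpace.norm_sq_eq, EuclideanSpace.norm_sq_eq]
    refine (Fintype.sum_of_injective (extendBits e) (extendBits_injective e) _ _
      (fun x hx => ?_) fun y => rfl).symm
    rw [hout, if_neg, norm_zero, zero_pow two_ne_zero]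
    refine fun hx' => hx ⟨fun i => x (e i), funext fun i => ?_⟩
    by_cases hi : i ∈ Set.range e
    · obtain ⟨j, rfl⟩ := hi
      rw [hext]
    · rw [hx' i hi]
      exact Function.extend_apply' (fun j => x (e j)) (0 : Bits n) i (by simpa using hi)
  rw [hres, norm_smul, mul_pow, norm_signVec_sq, norm_pow, Complex.norm_real, ← pow_mul,
    mul_comm m, pow_mul, Real.norm_eq_abs, sq_abs, div_pow, Real.sq_sqrt (by norm_num)] at hnorm
  have h1 : ‖Circuit.output V‖ ^ 2 = 1 := by
    rw [hnorm]
    simp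
  exact (pow_eq_one_iff_of_nonneg (norm_nonneg _) two_ne_zero).1 h1

/-! ### Choice of the number of qubits and asymptotics -/

lemma circuitComplexity_output_le {n : ℕ} (V : Circuit n) :
    circuitComplexity (Circuit.output V) ≤ V.length :=
  iInf₂_le (f := fun (W : Circuit n) (_ : Circuit.output W = Circuit.output V) =>
    (W.length : ℕ∞)) V rfl

lemma output_nil (n : ℕ) : Circuit.output ([] : Circuit n) = ketZero n := by
  simp [Circuit.output, Circuit.toMatrix]

lemma norm_ketZero (n : ℕ) : ‖ketZero n‖ = 1 := by
  simp [ketZero]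

/-- If `2 ^ m` is nearly proportional to `M`, then `m` is logarithmic in `M`. -/
lemma le_log_of_two_pow_lt {m : ℕ} {M ε : ℝ} (hm : 1 ≤ m) (hM : 1 ≤ M) (hε : 0 < ε) (hε1 : ε ≤ 1)
    (h : 2 ^ m < 50 * M * m ^ 2 / ε ^ 2) : (m : ℝ) ≤ 15 * ((1 + Real.log M) / ε) := by
  have hm0 : (0 : ℝ) < m := by exact_mod_cast hm
  have hlog := Real.log_lt_log (by positivity) h
  rw [Real.log_div (by positivity) (by positivity), Real.log_mul (by positivity) (by positivity),
    Real.log_mul (by positivity) (by positivity), Real.log_pow, Real.log_pow, Real.log_pow] at hlog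
  have h2 := Real.log_two_gt_d9
  have h2' := Real.log_two_lt_d9
  have h50 : Real.log 50 ≤ 6 * Real.log 2 := by
    rw [← Real.log_rpow (by norm_num)]
    exact Real.log_le_log (by norm_num) (by norm_num)
  -- The tangent at `8` costs `m / 4` for the term `2 log m`, leaving the positive slope `log 2 -
  -- 1/4` on the left.
  have hm8 : Real.log m ≤ m / 8 + 3 * Real.log 2 - 1 := by
    have h1 := Real.log_le_sub_one_of_pos (show (0 : ℝ) < m / 8 by positivity)
    rw [Real.log_div (by positivity) (by norm_num), show (8 : ℝ) = 2 ^ 3 by norm_num,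
      Real.log_pow] at h1
    push_cast at h1
    norm_num at h1 ⊢
    linarith
  have hlε : -Real.log ε ≤ 1 / ε - 1 := by
    rw [← Real.log_inv, ← one_div]
    exact Real.log_le_sub_one_of_pos (by positivity)
  have hM0 := Real.log_nonneg hM
  have hε2 : 1 ≤ 1 / ε := by rwa [le_div_iff₀ hε, one_mul]
  have hfin : (1 + Real.log M) / ε = 1 / ε + Real.log M * (1 / ε) := by ring
  rw [hfin]
  push_cast at hlog
  nlinarith [mul_le_mul_of_nonneg_left hε2 hM0]

/-- Hard states from circuits of nearly linear size in the rank. -/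
lemma exists_circuit_of_rank_le {δ : ℝ} (hδ : 0 ≤ δ) (hδ1 : δ < 1) {n M : ℕ}
    (hM : (M : ℝ) ≤ 1 / 25 * ((1 - δ ^ 2) ^ 2 * 2 ^ n / (n : ℝ) ^ 2)) :
    ∃ V : Circuit n, (V.length : ℝ) ≤
        675000 / (1 - δ ^ 2) ^ 5 * (M * (1 + Real.log M) ^ 5) ∧
      ‖Circuit.output V‖ = 1 ∧ M ≤ approxStabRank δ (Circuit.output V) := by
  rcases Nat.eq_zero_or_pos M with rfl | hM1
  · exact ⟨[], by simp, by rw [output_nil, norm_ketZero], Nat.zero_le _⟩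
  have hM1' : (1 : ℝ) ≤ M := by exact_mod_cast hM1
  set ε := 1 - δ ^ 2 with hεdef
  have hε : 0 < ε := by nlinarith
  have hε1 : ε ≤ 1 := by nlinarith
  have hn : n ≠ 0 := by
    rintro rfl
    norm_num at hM
    linarith
  classical
  have hex : ∃ m : ℕ, 1 ≤ m ∧ (M : ℝ) ≤ 1 / 25 * (ε ^ 2 * 2 ^ m / (m : ℝ) ^ 2) :=
    ⟨n, Nat.one_le_iff_ne_zero.2 hn, hM⟩
  -- Failure of the bound at `m - 1` yields the upper bound on `2 ^ m`, which makes the circuit size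
  -- depend on `M` rather than on `n`.
  obtain ⟨m, ⟨hm1, hmM⟩, hmin⟩ : ∃ m : ℕ, (1 ≤ m ∧
      (M : ℝ) ≤ 1 / 25 * (ε ^ 2 * 2 ^ m / (m : ℝ) ^ 2)) ∧
      ∀ k : ℕ, (1 ≤ k ∧ (M : ℝ) ≤ 1 / 25 * (ε ^ 2 * 2 ^ k / (k : ℝ) ^ 2)) → m ≤ k :=
    ⟨Nat.find hex, Nat.find_spec hex, fun k hk => Nat.find_min' hex hk⟩
  have hmn : m ≤ n := hmin n ⟨Nat.one_le_iff_ne_zero.2 hn, hM⟩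
  have hm0 : (0 : ℝ) < m := by exact_mod_cast hm1
  have hεsq : ε ^ 2 ≤ ε := by nlinarith
  have h2m : (0 : ℝ) < 2 ^ m := by positivity
  have hmM' : 25 * (m : ℝ) ^ 2 * M ≤ ε ^ 2 * 2 ^ m := by
    rw [mul_div_assoc', one_div_mul_eq_div, div_div, le_div_iff₀ (by positivity)] at hmM
    linarith
  -- The slack between `25` and `24` supplies the strict inequality.
  obtain ⟨V, hV, hVn, hVr⟩ := exists_circuit_approxStabRank hmn hδ hm1 (M := M) (by
    have h1 : 0 < (m : ℝ) ^ 2 * M := by positivity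
    have h3 : ε ^ 2 * 2 ^ m ≤ ε * 2 ^ m := by gcongr
    rw [← hεdef]
    linarith)
  refine ⟨V, ?_, hVn, hVr⟩
  -- This puts `m - 1` in the range `1 ≤ k` covered by minimality.
  have hm2 : m ≠ 1 := by
    rintro rfl
    norm_num at hmM'
    nlinarith
  obtain ⟨k, rfl⟩ : ∃ k, m = k + 1 := ⟨m - 1, by omega⟩
  have hk0 : 1 ≤ k := by omega
  have hk1 : (0 : ℝ) < k := by exact_mod_cast hk0
  have hlt : 1 / 25 * (ε ^ 2 * 2 ^ k / (k : ℝ) ^ 2) < M := by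
    by_contra! hcon
    have := hmin k ⟨hk0, hcon⟩
    omega
  have hpow : (2 : ℝ) ^ (k + 1) < 50 * M * ((k + 1 : ℕ) : ℝ) ^ 2 / ε ^ 2 := by
    rw [mul_div_assoc', one_div_mul_eq_div, div_div, div_lt_iff₀ (by positivity)] at hlt
    rw [lt_div_iff₀ (by positivity), pow_succ]
    have : M * (k : ℝ) ^ 2 ≤ M * ((k + 1 : ℕ) : ℝ) ^ 2 := by
      gcongr
      omega
    linarith
  have hmlog := le_log_of_two_pow_lt hm1 hM1' hε hε1 hpow
  generalize k + 1 = m at *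
  set L := 1 + Real.log M with hL
  have hL1 : 1 ≤ L := by linarith [Real.log_nonneg hM1']
  have hm1' : (1 : ℝ) ≤ m := by exact_mod_cast hm1
  have h2m1 : (1 : ℝ) ≤ 2 ^ m := one_le_pow₀ (by norm_num)
  have hlen : (V.length : ℝ) ≤ 2 ^ m * (2 * m + 1) + m := by exact_mod_cast hV
  calc (V.length : ℝ) ≤ 2 ^ m * (4 * m) := by nlinarith
    _ ≤ 50 * M * m ^ 2 / ε ^ 2 * (4 * m) := by gcongr
    _ = 200 * M / ε ^ 2 * (m : ℝ) ^ 3 := by ring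
    _ ≤ 200 * M / ε ^ 2 * (15 * (L / ε)) ^ 3 := by gcongr
    _ = 675000 / ε ^ 5 * (M * L ^ 3) := by field_simp; ring
    -- The logarithm is raised from power `3` to `5` because one `K` serves as both exponents.
    _ ≤ 675000 / ε ^ 5 * (M * L ^ 5) := by
      gcongr
      · norm_num

lemma eventually_rpow_le_two_pow (d : ℝ) {b : ℝ} (hb : 0 < b) :
    ∀ᶠ n : ℕ in Filter.atTop, (n : ℝ) ^ d + 1 ≤ b * (2 ^ n / (n : ℝ) ^ 2) := by
  have hlog : 0 < Real.log 2 := Real.log_pos (by norm_num)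
  have h1 : ∀ s : ℝ, ∀ᶠ n : ℕ in Filter.atTop, (n : ℝ) ^ s ≤ b / 2 * 2 ^ n := by
    intro s
    -- Half of `b` is reserved for each summand: exponent `d + 2` for `n ^ d` and `2` for the
    -- rounding term, after clearing `n ^ 2`.
    have := ((isLittleO_rpow_exp_pos_mul_atTop s hlog).comp_tendsto
      tendsto_natCast_atTop_atTop).bound (half_pos hb)
    filter_upwards [this] with n hn
    refine (le_abs_self _).trans (hn.trans_eq ?_)
    simp only [Function.comp_apply, Real.norm_eq_abs, abs_of_pos (Real.exp_pos _)]
    rw [mul_comm (Real.log 2), Real.exp_nat_mul, Real.exp_log (by norm_num)]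
  filter_upwards [h1 (d + 2), h1 2, Filter.eventually_gt_atTop 0] with n h2 h3 hn
  have hn0 : (0 : ℝ) < n := by exact_mod_cast hn
  rw [mul_div_assoc', le_div_iff₀ (by positivity)]
  rw [Real.rpow_add hn0] at h2
  norm_num at h2 h3
  linarith

lemma exists_hard_states_of_nonpos {d δ : ℝ} (hd : d ≤ 0) (hδ : 0 ≤ δ) {n : ℕ} (hn : 1 ≤ n) :
    ∃ ψ : QState n, ‖ψ‖ = 1 ∧ circuitComplexity ψ = 0 ∧
      (n : ℝ) ^ d ≤ approxStabRank δ ψ := by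
  refine ⟨ketZero n, norm_ketZero n, ?_, ?_⟩
  · have := circuitComplexity_output_le ([] : Circuit n)
    rw [output_nil] at this
    simpa using this
  · refine (Real.rpow_le_one_of_one_le_of_nonpos (by exact_mod_cast hn) hd).trans ?_
    exact_mod_cast approxStabRank_pos hδ (ketZero n)

lemma exists_hard_states_of_pos {d δ : ℝ} (hd : 0 < d) (hδ : 0 ≤ δ) (hδ1 : δ < 1) :
    ∃ (A : ℝ) (K N : ℕ), ∀ n : ℕ, N ≤ n → ∃ V : Circuit n, ‖Circuit.output V‖ = 1 ∧
      (V.length : ℝ) ≤ A * ((n : ℝ) ^ d * Real.log n ^ K) ∧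
      (n : ℝ) ^ d ≤ approxStabRank δ (Circuit.output V) := by
  have hε : 0 < 1 - δ ^ 2 := by nlinarith
  obtain ⟨N, hN⟩ := Filter.eventually_atTop.1 (eventually_rpow_le_two_pow d
    (b := 1 / 25 * (1 - δ ^ 2) ^ 2) (by positivity))
  -- From `n ≥ 3 > e` comes `log n ≥ 1`, so `1 + log M ≤ (2 + d) log n`; the factor `2` pays for
  -- rounding `n ^ d` up.
  refine ⟨675000 / (1 - δ ^ 2) ^ 5 * 2 * (2 + d) ^ 5, 5, max N 3, fun n hn => ?_⟩
  have hn3 : (3 : ℝ) ≤ n := by exact_mod_cast (le_max_right _ _).trans hn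
  have hnd : (1 : ℝ) ≤ (n : ℝ) ^ d := Real.one_le_rpow (by linarith) hd.le
  have hceil := (Nat.ceil_lt_add_one (show 0 ≤ (n : ℝ) ^ d by positivity)).le
  set M := ⌈(n : ℝ) ^ d⌉₊ with hMdef
  have hle : (n : ℝ) ^ d ≤ M := Nat.le_ceil _
  obtain ⟨V, hV, hVn, hVr⟩ := exists_circuit_of_rank_le hδ hδ1 (n := n) (M := M) (by
    refine hceil.trans ((hN n ((le_max_left _ _).trans hn)).trans_eq ?_)
    ring)
  refine ⟨V, hVn, hV.trans ?_, hle.trans (by exact_mod_cast hVr)⟩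
  have hlogn : 1 ≤ Real.log n := by
    rw [Real.le_log_iff_exp_le (by linarith)]
    linarith [Real.exp_one_lt_d9]
  have hM2 : (M : ℝ) ≤ 2 * (n : ℝ) ^ d := by linarith
  have hM1 : (1 : ℝ) ≤ M := hnd.trans hle
  have hlogM : Real.log M ≤ 1 + d * Real.log n := by
    refine (Real.log_le_log (by linarith) hM2).trans ?_
    rw [Real.log_mul (by norm_num) (by positivity), Real.log_rpow (by linarith)]
    linarith [Real.log_two_lt_d9]
  have h0 := Real.log_nonneg hM1
  calc _ ≤ 675000 / (1 - δ ^ 2) ^ 5 * (2 * (n : ℝ) ^ d * ((2 + d) * Real.log n) ^ 5) := by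
        gcongr
        linarith
    _ = _ := by ring

end StabRank

theorem mainTheorem5 :
    (∃ c : ℝ, 0 < c ∧ ∃ (A : ℝ) (K : ℕ),
      ∀ δ : ℝ, 0 ≤ δ → δ < 1 →
      ∀ n M : ℕ, (M : ℝ) ≤ c * ((1 - δ ^ 2) ^ 2 * 2 ^ n / (n : ℝ) ^ 2) →
        ∃ V : StabRank.Circuit n,
          (V.length : ℝ) ≤ A / (1 - δ ^ 2) ^ K * (M * (1 + Real.log M) ^ K) ∧
          M ≤ StabRank.approxStabRank δ (StabRank.Circuit.output V)) ∧
    (∀ d δ : ℝ, 0 ≤ δ → δ < 1 →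
      ∃ (A : ℝ) (K N : ℕ), ∀ n : ℕ, N ≤ n →
        ∃ ψ : StabRank.QState n, ‖ψ‖ = 1 ∧
          (StabRank.circuitComplexity ψ : ENNReal) ≤
            ENNReal.ofReal (A * ((n : ℝ) ^ d * Real.log n ^ K)) ∧
          (n : ℝ) ^ d ≤ StabRank.approxStabRank δ ψ ∧
          (n : ℝ) ^ d ≤ StabRank.stabRank ψ) := by
  refine ⟨⟨1 / 25, by norm_num, 675000, 5, fun δ hδ hδ1 n M hM => ?_⟩, fun d δ hδ hδ1 => ?_⟩
  · obtain ⟨V, hV, -, hVr⟩ := StabRank.exists_circuit_of_rank_le hδ hδ1 hM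
    exact ⟨V, hV, hVr⟩
  · rcases le_or_gt d 0 with hd | hd
    · refine ⟨0, 0, 1, fun n hn => ?_⟩
      obtain ⟨ψ, hψ, hc, hr⟩ := StabRank.exists_hard_states_of_nonpos hd hδ hn
      refine ⟨ψ, hψ, by simp [hc], hr, hr.trans ?_⟩
      exact_mod_cast StabRank.approxStabRank_le_stabRank hδ ψ
    · obtain ⟨A, K, N, h⟩ := StabRank.exists_hard_states_of_pos hd hδ hδ1
      refine ⟨A, K, N, fun n hn => ?_⟩
      obtain ⟨V, hV, hlen, hr⟩ := h n hn
      refine ⟨_, hV, ?_, hr, hr.trans ?_⟩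
      · refine (ENat.toENNReal_le.2 (StabRank.circuitComplexity_output_le V)).trans ?_
        rw [ENat.toENNReal_coe, ← ENNReal.ofReal_natCast]
        exact ENNReal.ofReal_le_ofReal hlen
      · exact_mod_cast StabRank.approxStabRank_le_stabRank hδ _
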